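/- Let $\mathfrak g$ be a $4$-dimensional real Lie algebra that is unimodular, i.e. $\operatorname{tr}(\operatorname{ad}_\xi)=0$ for all $\xi\in\mathfrak g$. Let $\mathcal Z\subset\Lambda^2(\mathfrak g^*)$ be the space of closed $2$-forms for the Chevalley–Eilenberg differential (with trivial real coefficients), $\mathcal B\subset\mathcal Z$ the space of exact $2$-forms, and $H^2(\mathfrak g)=\mathcal Z/\mathcal B$. Fix a nonzero $\zeta\in\Lambda^4(\mathfrak g)$ and let $b^+$ be the maximal dimension of a subspace of $\mathcal Z$ on which the symmetric form $\Phi_\zeta(\alpha,\beta)=(\alpha\wedge\beta)(\zeta)$ is positive definite. An almost complex structure on $\mathfrak g$ is a linear map $J:\mathfrak g\to\mathfrak g$ with $J^2=-\mathrm{id}$. It is integrable if $[u,v]+J[Ju,v]+J[u,Jv]-[Ju,Jv]=0$ for all $u,v\in\mathfrak g$. It is tamed if there is $\varphi\in\mathcal Z$ with $\varphi(v,Jv)>0$ for all $v\ne 0$. Let $\Lambda^-_J(\mathfrak g^*)=\{\alpha\in\Lambda^2(\mathfrak g^*):\alpha(Ju,Jv)=-\alpha(u,v)\ \text{for all}\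 u,v\in\mathfrak g\}$, let $H^-_J(\mathfrak g)\subset H^2(\mathfrak g)$ be the subspace of classes represented by elements of $\mathcal Z\cap\Lambda^-_J(\mathfrak g^*)$, and let $h^-_J=\dim H^-_J(\mathfrak g)$. 1. If $b^+=3$, then every almost complex structure $J$ on $\mathfrak g$ is tamed and integrable, and $h^-_J=2$. 2. If $b^+=2$, then every almost complex structure $J$ on $\mathfrak g$ is either tamed or integrable, and not both; moreover $J$ is tamed if and only if $h^-_J=1$, and $J$ is integrable if and only if $\Lambda^-_J(\mathfrak g^*)\subset\mathcal Z$. 3. If $b^+=1$, then for every almost complex structure $J$ on $\mathfrak g$ exactly one of the following holds: $J$ is tamed, or $\Lambda^-_J(\mathfrak g^*)\cap\mathcal Z\neq\{0\}$. -/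

import Mathlib

open LieModule.Cohomology

noncomputable section

namespace LieAC

variable (g : Type*) [LieRing g] [LieAlgebra ℝ g]

/-- `tr (ad ξ) = 0` for all `ξ`. -/
def IsUnimodular : Prop :=
  ∀ ξ : g, LinearMap.trace ℝ g (LieAlgebra.ad ℝ g ξ) = 0

/-- `Λ²(g*)`: alternating bilinear forms on `g`, i.e. Chevalley-Eilenberg 2-cochains with
coefficients in the trivial module `ℝ`. -/
def TwoForm : Type _ := twoCochain ℝ g (TrivialLieModule ℝ g ℝ)

instance : AddCommGroup (TwoForm g) :=
  inferInstanceAs (AddCommGroup (twoCochain ℝ g (TrivialLieModule ℝ g ℝ)))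

instance : Module ℝ (TwoForm g) :=
  inferInstanceAs (Module ℝ (twoCochain ℝ g (TrivialLieModule ℝ g ℝ)))

/-- Closed 2-forms. -/
def closedForms : Submodule ℝ (TwoForm g) := twoCocycle ℝ g (TrivialLieModule ℝ g ℝ)

/-- Exact 2-forms `dφ`, where `dφ (u, v) = -φ [u, v]`. -/
def exactForms : Submodule ℝ (TwoForm g) :=
  LinearMap.range (d₁₂ ℝ g (TrivialLieModule ℝ g ℝ))

/-- The second Chevalley-Eilenberg cohomology: closed 2-forms modulo exact 2-forms. -/
abbrev H2 := closedForms g ⧸ (exactForms g).comap (closedForms g).subtype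

variable {g}

/-- The real number `α (u, v)`, as a bilinear function of `u` and `v`. -/
def TwoForm.ev (α : TwoForm g) : g →ₗ[ℝ] g →ₗ[ℝ] ℝ :=
  (Subtype.val α : g →ₗ[ℝ] g →ₗ[ℝ] TrivialLieModule ℝ g ℝ).compr₂
    (TrivialLieModule.equiv ℝ g ℝ).toLinearMap

@[simp] lemma ev_self (α : TwoForm g) (u : g) : α.ev u u = 0 :=
  α.property u

lemma ev_swap (α : TwoForm g) (u v : g) : α.ev v u = - α.ev u v := by
  have h := ev_self α (u + v)
  simp only [map_add, LinearMap.add_apply, ev_self] at h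
  linarith

@[simp] lemma zero_ev (u v : g) : (0 : TwoForm g).ev u v = 0 := rfl

@[simp] lemma add_ev (α β : TwoForm g) (u v : g) :
    (α + β).ev u v = α.ev u v + β.ev u v := rfl

@[simp] lemma smul_ev (c : ℝ) (α : TwoForm g) (u v : g) :
    (c • α).ev u v = c * α.ev u v := rfl

lemma mem_closedForms_iff (α : TwoForm g) :
    α ∈ closedForms g ↔
      ∀ u v w : g, α.ev u ⁅v, w⁆ = α.ev ⁅u, v⁆ w + α.ev v ⁅u, w⁆ := by
  exact mem_twoCocycle_iff_of_trivial ℝ g (TrivialLieModule ℝ g ℝ) α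

lemma mem_exactForms_iff (α : TwoForm g) :
    α ∈ exactForms g ↔ ∃ φ : g →ₗ[ℝ] ℝ, ∀ u v : g, α.ev u v = - φ ⁅u, v⁆ := by
  constructor
  · rintro ⟨φ, rfl⟩
    have h₁ := d₁₂_apply_apply_ofTrivial ℝ g (TrivialLieModule ℝ g ℝ) φ
    exact ⟨(TrivialLieModule.equiv ℝ g ℝ).toLinearMap ∘ₗ φ, h₁⟩
  · rintro ⟨φ, h⟩
    let ψ : g →ₗ[ℝ] TrivialLieModule ℝ g ℝ :=
      (TrivialLieModule.equiv ℝ g ℝ).symm.toLinearMap ∘ₗ φ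
    have h₁ := d₁₂_apply_apply_ofTrivial ℝ g (TrivialLieModule ℝ g ℝ) ψ
    refine ⟨ψ, Subtype.ext (LinearMap.ext fun u => LinearMap.ext fun v => ?_)⟩
    exact (h₁ u v).trans (h u v).symm

/-- The wedge product of two 2-forms (the sum over (2,2)-shuffles). -/
def wedge (α β : TwoForm g) : g [⋀^Fin 4]→ₗ[ℝ] ℝ where
  toFun v :=
    α.ev (v 0) (v 1) * β.ev (v 2) (v 3) - α.ev (v 0) (v 2) * β.ev (v 1) (v 3)
      + α.ev (v 0) (v 3) * β.ev (v 1) (v 2) + α.ev (v 1) (v 2) * β.ev (v 0) (v 3)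
      - α.ev (v 1) (v 3) * β.ev (v 0) (v 2) + α.ev (v 2) (v 3) * β.ev (v 0) (v 1)
  map_update_add' := by
    intro inst v i x y
    obtain rfl : inst = instDecidableEqFin 4 := Subsingleton.elim _ _
    fin_cases i <;> simp [Function.update] <;> ring
  map_update_smul' := by
    intro inst v i c x
    obtain rfl : inst = instDecidableEqFin 4 := Subsingleton.elim _ _
    fin_cases i <;> simp [Function.update] <;> ring
  map_eq_zero_of_eq' v i j h hij := by
    have s10 := fun γ : TwoForm g => ev_swap γ (v 0) (v 1)
    have s20 := fun γ : TwoForm g => ev_swap γ (v 0) (v 2)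
    have s21 := fun γ : TwoForm g => ev_swap γ (v 1) (v 2)
    have h' := h.symm
    rcases (by omega : i = 0 ∨ i = 1 ∨ i = 2 ∨ i = 3) with rfl | rfl | rfl | rfl <;>
    rcases (by omega : j = 0 ∨ j = 1 ∨ j = 2 ∨ j = 3) with rfl | rfl | rfl | rfl <;>
    first
    | exact absurd rfl hij
    | (simp only [h', ev_self, s10, s20, s21]; ring1)
    | (simp only [h, ev_self, s10, s20, s21]; ring1)

/-- The pairing `Φ_ζ (α, β) = (α ∧ β) (ζ)` of 2-forms, for a 4-vector `ζ`. -/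
def pairing (ζ : ⋀[ℝ]^4 g) (α β : TwoForm g) : ℝ :=
  exteriorPower.alternatingMapLinearEquiv (wedge α β) ζ

/-- `V` is positive definite with respect to `Φ_ζ`. -/
def IsPosDef (ζ : ⋀[ℝ]^4 g) (V : Submodule ℝ (TwoForm g)) : Prop :=
  ∀ α ∈ V, α ≠ 0 → 0 < pairing ζ α α

/-- `b⁺`: the maximal dimension of a subspace of the space of closed 2-forms that is positive
definite with respect to `Φ_ζ`. -/
def bPlus (ζ : ⋀[ℝ]^4 g) : ℕ :=
  sSup {n : ℕ | ∃ V : Submodule ℝ (TwoForm g),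
    V ≤ closedForms g ∧ IsPosDef ζ V ∧ Module.finrank ℝ V = n}

/-- An almost complex structure on `g`. -/
def IsAlmostComplex (J : g →ₗ[ℝ] g) : Prop := ∀ v, J (J v) = -v

/-- `J` is integrable: its Nijenhuis tensor vanishes. -/
def IsIntegrable (J : g →ₗ[ℝ] g) : Prop :=
  ∀ u v : g, ⁅u, v⁆ + J ⁅J u, v⁆ + J ⁅u, J v⁆ - ⁅J u, J v⁆ = 0

/-- There is a closed 2-form which is positive on `v ∧ J v` for every nonzero `v`. -/
def IsTamed (J : g →ₗ[ℝ] g) : Prop :=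
  ∃ φ ∈ closedForms g, ∀ v : g, v ≠ 0 → 0 < φ.ev v (J v)

/-- `Λ⁻_J(g*)`: the `J`-anti-invariant 2-forms. -/
def antiInvariant (J : g →ₗ[ℝ] g) : Submodule ℝ (TwoForm g) where
  carrier := {α | ∀ u v, α.ev (J u) (J v) = - α.ev u v}
  add_mem' {a b} ha hb u v := by
    rw [add_ev, add_ev, ha u v, hb u v]; ring
  zero_mem' u v := by simp
  smul_mem' c a ha u v := by
    rw [smul_ev, smul_ev, ha u v]; ring

/-- `H⁻_J(g)`: the classes in `H²(g)` represented by closed `J`-anti-invariant 2-forms. -/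
def HMinus (J : g →ₗ[ℝ] g) : Submodule ℝ (H2 g) :=
  ((antiInvariant J).comap (closedForms g).subtype).map
    ((exactForms g).comap (closedForms g).subtype).mkQ

/-- `h⁻_J = dim H⁻_J(g)`. -/
def hMinus (J : g →ₗ[ℝ] g) : ℕ := Module.finrank ℝ (HMinus J)

end LieAC

end

/-! Write Z, B for the closed and exact 2-forms and r = dim B. On the 6-dimensional space Λ² the
wedge form has signature (3,3). Unimodularity kills d on 3-forms, so dφ ∧ β = φ ∧ dβ, and hence Z =
B^⊥ (`closedForms_eq_orthogonal`). Since B ⊂ Z, B is isotropic and is the radical of the form on Z,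
so b⁺ = 3 - r (`bPlus_add_finrank_exactForms`).

Given J, the anti-invariant forms Λ⁻ are a definite plane whose orthogonal complement Λ⁺ consists of
the J-invariant forms. From (Z + Λ⁻)^⊥ = B ∩ Λ⁺ one gets dim(Z ∩ Λ⁻) = 2 - r + dim(B ∩ Λ⁺)
(`finrank_closed_inf_antiInvariant`). Definiteness gives B ∩ Λ⁻ = 0, so the left side is h⁻_J.
Moreover J is tamed iff B ∩ Λ⁺ = 0 (`isTamed_iff`), and for r = 1 it is integrable iff B ⊂ Λ⁺
(`isIntegrable_iff`). The three claims are the cases r = 0, 1, 2. -/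

noncomputable section

namespace LieAC

variable {g : Type*} [LieRing g] [LieAlgebra ℝ g]

/-! ### 2-forms in coordinates and the wedge form -/

/-- The 2-form `φ ∧ ψ`. -/
def wedgeOne (φ ψ : g →ₗ[ℝ] ℝ) : TwoForm g :=
  ⟨(LinearMap.mk₂ ℝ (fun u v => φ u * ψ v - ψ u * φ v)
      (fun u u' v => by simp; ring) (fun c u v => by simp; ring)
      (fun u v v' => by simp; ring) (fun c u v => by simp; ring)).compr₂
        (TrivialLieModule.equiv ℝ g ℝ).symm.toLinearMap, by
    intro u
    simp [mul_comm]⟩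

@[simp] lemma wedgeOne_ev (φ ψ : g →ₗ[ℝ] ℝ) (u v : g) :
    (wedgeOne φ ψ).ev u v = φ u * ψ v - ψ u * φ v := by
  simp [wedgeOne, TwoForm.ev]

lemma ext_ev {α β : TwoForm g} (h : ∀ u v, α.ev u v = β.ev u v) : α = β :=
  Subtype.ext (LinearMap.ext fun u => LinearMap.ext fun v => h u v)

/-- The exact 2-form `dφ`. -/
lemma exists_exactForm (φ : g →ₗ[ℝ] ℝ) : ∃ α ∈ exactForms g, ∀ u v, α.ev u v = -φ ⁅u, v⁆ := by
  let ψ : g →ₗ[ℝ] TrivialLieModule ℝ g ℝ :=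
    (TrivialLieModule.equiv ℝ g ℝ).symm.toLinearMap ∘ₗ φ
  exact ⟨LieModule.Cohomology.d₁₂ ℝ g (TrivialLieModule ℝ g ℝ) ψ, ⟨ψ, rfl⟩,
    LieModule.Cohomology.d₁₂_apply_apply_ofTrivial ℝ g (TrivialLieModule ℝ g ℝ) ψ⟩

/-- The six coordinates of a 2-form in a basis of `g`. -/
def coords (b : Fin 4 → g) : TwoForm g →ₗ[ℝ] Fin 6 → ℝ where
  toFun α := ![α.ev (b 0) (b 1), α.ev (b 0) (b 2), α.ev (b 0) (b 3),
    α.ev (b 1) (b 2), α.ev (b 1) (b 3), α.ev (b 2) (b 3)]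
  map_add' α β := by simp
  map_smul' c α := by simp

lemma coords_apply (b : Fin 4 → g) (α : TwoForm g) :
    coords b α = ![α.ev (b 0) (b 1), α.ev (b 0) (b 2), α.ev (b 0) (b 3),
      α.ev (b 1) (b 2), α.ev (b 1) (b 3), α.ev (b 2) (b 3)] := rfl

/-- The 2-form with prescribed coordinates in a basis of `g`. -/
def ofCoords (b : Module.Basis (Fin 4) ℝ g) (a : Fin 6 → ℝ) : TwoForm g :=
  a 0 • wedgeOne (b.coord 0) (b.coord 1) + a 1 • wedgeOne (b.coord 0) (b.coord 2)
  + a 2 • wedgeOne (b.coord 0) (b.coord 3) + a 3 • wedgeOne (b.coord 1) (b.coord 2)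
  + a 4 • wedgeOne (b.coord 1) (b.coord 3) + a 5 • wedgeOne (b.coord 2) (b.coord 3)

lemma ext_basis (b : Module.Basis (Fin 4) ℝ g) {α β : TwoForm g}
    (h01 : α.ev (b 0) (b 1) = β.ev (b 0) (b 1)) (h02 : α.ev (b 0) (b 2) = β.ev (b 0) (b 2))
    (h03 : α.ev (b 0) (b 3) = β.ev (b 0) (b 3)) (h12 : α.ev (b 1) (b 2) = β.ev (b 1) (b 2))
    (h13 : α.ev (b 1) (b 3) = β.ev (b 1) (b 3)) (h23 : α.ev (b 2) (b 3) = β.ev (b 2) (b 3)) :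
    α = β := by
  have : α.ev = β.ev := by
    refine b.ext fun i => b.ext fun j => ?_
    fin_cases i <;> fin_cases j <;>
    first
    | assumption
    | (simp only [Fin.zero_eta, Fin.mk_one, Fin.reduceFinMk, ev_self]; done)
    | (simp only [Fin.zero_eta, Fin.mk_one, Fin.reduceFinMk]
       rw [ev_swap α, ev_swap β, neg_inj]
       assumption)
  exact ext_ev fun u v => by rw [this]

/-- The coordinates of a 2-form in a basis of `g`, as a linear equivalence. -/
def coordsEquiv (b : Module.Basis (Fin 4) ℝ g) : TwoForm g ≃ₗ[ℝ] Fin 6 → ℝ :=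
  LinearEquiv.ofBijective (coords b) <| by
    constructor
    · intro α β h
      have h' := fun i => congrFun h i
      exact ext_basis b (h' 0) (h' 1) (h' 2) (h' 3) (h' 4) (h' 5)
    · intro a
      refine ⟨ofCoords b a, ?_⟩
      funext i
      fin_cases i <;> simp [coords_apply, ofCoords]

/-- The value of `α ∧ β` on a basis, as a bilinear form. -/
def wedgeForm (b : Fin 4 → g) : LinearMap.BilinForm ℝ (TwoForm g) :=
  LinearMap.mk₂ ℝ (fun α β => wedge α β b)
    (fun α α' β => by simp [wedge]; ring) (fun c α β => by simp [wedge]; ring)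
    (fun α β β' => by simp [wedge]; ring) (fun c α β => by simp [wedge]; ring)

lemma wedgeForm_apply (b : Fin 4 → g) (α β : TwoForm g) :
    wedgeForm b α β =
      α.ev (b 0) (b 1) * β.ev (b 2) (b 3) - α.ev (b 0) (b 2) * β.ev (b 1) (b 3)
      + α.ev (b 0) (b 3) * β.ev (b 1) (b 2) + α.ev (b 1) (b 2) * β.ev (b 0) (b 3)
      - α.ev (b 1) (b 3) * β.ev (b 0) (b 2) + α.ev (b 2) (b 3) * β.ev (b 0) (b 1) := rfl

lemma wedgeForm_isSymm (b : Fin 4 → g) : (wedgeForm b).IsSymm :=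
  ⟨fun α β => by simp only [wedgeForm_apply]; ring⟩

lemma finrank_twoForm (b : Module.Basis (Fin 4) ℝ g) : Module.finrank ℝ (TwoForm g) = 6 := by
  simpa using (coordsEquiv b).finrank_eq

lemma finite_twoForm (b : Module.Basis (Fin 4) ℝ g) : Module.Finite ℝ (TwoForm g) :=
  Module.Finite.equiv (coordsEquiv b).symm

/-- Wedging with a product of two coordinate forms reads off, up to sign, the complementary
coordinate. -/
lemma wedgeForm_nondegenerate (b : Module.Basis (Fin 4) ℝ g) : (wedgeForm b).Nondegenerate := by
  refine ((wedgeForm_isSymm b).isRefl.nondegenerate_iff_separatingLeft).2 fun α h => ?_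
  have H := fun i j => h (wedgeOne (b.coord i) (b.coord j))
  simp only [wedgeForm_apply, wedgeOne_ev] at H
  have h01 := H 0 1
  have h02 := H 0 2
  have h03 := H 0 3
  have h12 := H 1 2
  have h13 := H 1 3
  have h23 := H 2 3
  simp at h01 h02 h03 h12 h13 h23
  apply ext_basis b <;> simp [*]

/-- Λ⁴ is a line, so ζ only contributes a nonzero scale c, of either sign. -/
lemma pairing_eq (b : Module.Basis (Fin 4) ℝ g) (ζ : ⋀[ℝ]^4 g) (hζ : ζ ≠ 0) :
    ∃ c : ℝ, c ≠ 0 ∧ ∀ α β : TwoForm g, pairing ζ α β = c * wedgeForm b α β := by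
  have key : ∀ f : g [⋀^Fin 4]→ₗ[ℝ] ℝ, exteriorPower.alternatingMapLinearEquiv f ζ =
      exteriorPower.alternatingMapLinearEquiv b.det ζ * f b := by
    intro f
    conv_lhs => rw [f.eq_smul_basis_det b]
    simp [mul_comm]
  refine ⟨_, fun h => hζ ?_, fun α β => key (wedge α β)⟩
  refine (Module.forall_dual_apply_eq_zero_iff ℝ ζ).1 fun ψ => ?_
  have := key (exteriorPower.alternatingMapLinearEquiv.symm ψ)
  rwa [h, zero_mul, LinearEquiv.apply_symm_apply] at this

/-! ### Closed forms as the orthogonal complement of exact forms -/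

/-- The expression whose vanishing is the closedness of `β`. -/
def closedDefect (β : TwoForm g) (u v w : g) : ℝ :=
  β.ev u ⁅v, w⁆ - β.ev ⁅u, v⁆ w - β.ev v ⁅u, w⁆

lemma closedDefect_swap_left (β : TwoForm g) (u v w : g) :
    closedDefect β v u w = - closedDefect β u v w := by
  have : ⁅v, u⁆ = -⁅u, v⁆ := (lie_skew _ _).symm
  simp only [closedDefect, this, map_neg, LinearMap.neg_apply]; ring

lemma closedDefect_swap_right (β : TwoForm g) (u v w : g) :
    closedDefect β u w v = - closedDefect β u v w := by
  have : ⁅w, v⁆ = -⁅v, w⁆ := (lie_skew _ _).symm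
  simp only [closedDefect, this, map_neg]
  rw [ev_swap β ⁅u, v⁆ w, ev_swap β v ⁅u, w⁆]
  ring

lemma eq_zero_of_skew {T : Fin 4 → Fin 4 → Fin 4 → ℝ} (hl : ∀ i j k, T j i k = - T i j k)
    (hr : ∀ i j k, T i k j = - T i j k) (h012 : T 0 1 2 = 0) (h013 : T 0 1 3 = 0)
    (h023 : T 0 2 3 = 0) (h123 : T 1 2 3 = 0) (i j k : Fin 4) : T i j k = 0 := by
  have dl : ∀ i k, T i i k = 0 := fun i k => by linarith [hl i i k]
  have dr : ∀ i k, T i k k = 0 := fun i k => by linarith [hr i k k]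
  have of_lt : ∀ i j k, i < j → j < k → T i j k = 0 := by
    intro i j k h1 h2
    fin_cases i <;> fin_cases j <;> fin_cases k <;> first | assumption | simp at h1 h2
  have of_lt_left : ∀ i j k, i < j → T i j k = 0 := by
    intro i j k h1
    rcases lt_trichotomy j k with h | rfl | h
    · exact of_lt i j k h1 h
    · exact dr _ _
    · rw [hr, neg_eq_zero]
      rcases lt_trichotomy i k with h' | rfl | h'
      · exact of_lt i k j h' h
      · exact dl _ _
      · rw [hl, neg_eq_zero]
        exact of_lt k i j h' h1
  rcases lt_trichotomy i j with h | rfl | h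
  · exact of_lt_left i j k h
  · exact dl _ _
  · rw [hl, neg_eq_zero]
    exact of_lt_left j i k h

lemma mem_closedForms_iff_basis (b : Module.Basis (Fin 4) ℝ g) (β : TwoForm g) :
    β ∈ closedForms g ↔ closedDefect β (b 0) (b 1) (b 2) = 0 ∧
      closedDefect β (b 0) (b 1) (b 3) = 0 ∧ closedDefect β (b 0) (b 2) (b 3) = 0 ∧
      closedDefect β (b 1) (b 2) (b 3) = 0 := by
  rw [mem_closedForms_iff]
  constructor
  · intro h
    refine ⟨?_, ?_, ?_, ?_⟩ <;> · rw [closedDefect, h]; ring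
  rintro ⟨h012, h013, h023, h123⟩
  have hb : ∀ i j k, closedDefect β (b i) (b j) (b k) = 0 := by
    intro i j k
    exact eq_zero_of_skew (T := fun i j k => closedDefect β (b i) (b j) (b k))
      (fun i j k => closedDefect_swap_left β _ _ _) (fun i j k => closedDefect_swap_right β _ _ _)
      h012 h013 h023 h123 i j k
  have h3 : ∀ i j w, closedDefect β (b i) (b j) w = 0 := by
    intro i j w
    rw [← b.sum_repr w, Fin.sum_univ_four]
    have := fun k => hb i j k
    simp only [closedDefect] at this
    simp only [closedDefect, map_add, map_smul, lie_add, lie_smul, smul_eq_mul]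
    linear_combination b.repr w 0 * this 0 + b.repr w 1 * this 1 + b.repr w 2 * this 2
      + b.repr w 3 * this 3
  have h2 : ∀ i v w, closedDefect β (b i) v w = 0 := by
    intro i v w
    rw [← b.sum_repr v, Fin.sum_univ_four]
    have := fun k => h3 i k w
    simp only [closedDefect] at this
    simp only [closedDefect, map_add, map_smul, lie_add, add_lie, lie_smul, smul_lie,
      LinearMap.add_apply, LinearMap.smul_apply, smul_eq_mul]
    linear_combination b.repr v 0 * this 0 + b.repr v 1 * this 1 + b.repr v 2 * this 2
      + b.repr v 3 * this 3
  intro u v w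
  have : closedDefect β u v w = 0 := by
    rw [← b.sum_repr u, Fin.sum_univ_four]
    have := fun k => h2 k v w
    simp only [closedDefect] at this
    simp only [closedDefect, map_add, map_smul, add_lie, smul_lie, LinearMap.add_apply,
      LinearMap.smul_apply, smul_eq_mul]
    linear_combination b.repr u 0 * this 0 + b.repr u 1 * this 1 + b.repr u 2 * this 2
      + b.repr u 3 * this 3
  simp only [closedDefect] at this
  linarith

lemma sum_coord_lie_eq_zero (hg : IsUnimodular g) (b : Module.Basis (Fin 4) ℝ g) (u : g) :
    b.coord 0 ⁅u, b 0⁆ + b.coord 1 ⁅u, b 1⁆ + b.coord 2 ⁅u, b 2⁆ + b.coord 3 ⁅u, b 3⁆ = 0 := by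
  have := hg u
  rw [LinearMap.trace_eq_matrix_trace ℝ b, Matrix.trace, Fin.sum_univ_four] at this
  simpa [LinearMap.toMatrix_apply] using this

lemma ev_eq_sum (b : Module.Basis (Fin 4) ℝ g) (β : TwoForm g) (u v : g) :
    β.ev u v = b.coord 0 u * β.ev (b 0) v + b.coord 1 u * β.ev (b 1) v
      + b.coord 2 u * β.ev (b 2) v + b.coord 3 u * β.ev (b 3) v := by
  conv_lhs => rw [← b.sum_repr u, Fin.sum_univ_four]
  simp

/-- For unimodular `g`, a 2-form is closed iff it is orthogonal to all exact 2-forms. -/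
lemma closedForms_eq_orthogonal (hg : IsUnimodular g) (b : Module.Basis (Fin 4) ℝ g) :
    closedForms g = (wedgeForm b).orthogonal (exactForms g) := by
  have lin : ∀ (φ : g →ₗ[ℝ] ℝ) (u : g), φ u = φ (b 0) * b.coord 0 u + φ (b 1) * b.coord 1 u
      + φ (b 2) * b.coord 2 u + φ (b 3) * b.coord 3 u := by
    intro φ u
    conv_lhs => rw [← b.sum_repr u, Fin.sum_univ_four]
    simp [mul_comm]
  have t0 := sum_coord_lie_eq_zero hg b (b 0)
  have t1 := sum_coord_lie_eq_zero hg b (b 1)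
  have t2 := sum_coord_lie_eq_zero hg b (b 2)
  have t3 := sum_coord_lie_eq_zero hg b (b 3)
  have s : ∀ i j, ⁅b j, b i⁆ = -⁅b i, b j⁆ := fun i j => (lie_skew _ _).symm
  rw [s 0 1] at t1
  rw [s 0 2, s 1 2] at t2
  rw [s 0 3, s 1 3, s 2 3] at t3
  simp only [lie_self, map_neg, map_zero] at t0 t1 t2 t3
  -- This is dφ ∧ β = φ ∧ dβ evaluated on the basis. The difference of the sides is d(φ ∧ β), a
  -- combination of the traces of ad (b i).
  have formula : ∀ (φ : g →ₗ[ℝ] ℝ) (α β : TwoForm g), (∀ u v, α.ev u v = -φ ⁅u, v⁆) →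
      wedgeForm b α β = φ (b 0) * closedDefect β (b 1) (b 2) (b 3)
        - φ (b 1) * closedDefect β (b 0) (b 2) (b 3)
        + φ (b 2) * closedDefect β (b 0) (b 1) (b 3)
        - φ (b 3) * closedDefect β (b 0) (b 1) (b 2) := by
    intro φ α β h
    have e : ∀ i j k, β.ev (b i) ⁅b j, b k⁆ = -(b.coord 0 ⁅b j, b k⁆ * β.ev (b 0) (b i)
        + b.coord 1 ⁅b j, b k⁆ * β.ev (b 1) (b i) + b.coord 2 ⁅b j, b k⁆ * β.ev (b 2) (b i)
        + b.coord 3 ⁅b j, b k⁆ * β.ev (b 3) (b i)) := by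
      intro i j k
      rw [ev_swap, ev_eq_sum b]
    simp only [wedgeForm_apply, h, lin φ ⁅_, _⁆, closedDefect, e]
    simp only [ev_eq_sum b β ⁅_, _⁆, ev_self, ev_swap β (b 0) (b 1), ev_swap β (b 0) (b 2),
      ev_swap β (b 0) (b 3), ev_swap β (b 1) (b 2), ev_swap β (b 1) (b 3), ev_swap β (b 2) (b 3)]
    linear_combination
      (φ (b 0) * β.ev (b 2) (b 3)) * t1 - (φ (b 1) * β.ev (b 2) (b 3)) * t0
      - (φ (b 0) * β.ev (b 1) (b 3)) * t2 + (φ (b 2) * β.ev (b 1) (b 3)) * t0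
      + (φ (b 0) * β.ev (b 1) (b 2)) * t3 - (φ (b 3) * β.ev (b 1) (b 2)) * t0
      + (φ (b 1) * β.ev (b 0) (b 3)) * t2 - (φ (b 2) * β.ev (b 0) (b 3)) * t1
      - (φ (b 1) * β.ev (b 0) (b 2)) * t3 + (φ (b 3) * β.ev (b 0) (b 2)) * t1
      + (φ (b 2) * β.ev (b 0) (b 1)) * t3 - (φ (b 3) * β.ev (b 0) (b 1)) * t2
  ext β
  rw [mem_closedForms_iff_basis b, LinearMap.BilinForm.mem_orthogonal_iff]
  constructor
  · rintro ⟨h012, h013, h023, h123⟩ α hα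
    obtain ⟨φ, h⟩ := (mem_exactForms_iff α).1 hα
    rw [formula φ α β h, h012, h013, h023, h123]
    ring
  · intro h
    have key : ∀ φ : g →ₗ[ℝ] ℝ, φ (b 0) * closedDefect β (b 1) (b 2) (b 3)
        - φ (b 1) * closedDefect β (b 0) (b 2) (b 3)
        + φ (b 2) * closedDefect β (b 0) (b 1) (b 3)
        - φ (b 3) * closedDefect β (b 0) (b 1) (b 2) = 0 := by
      intro φ
      obtain ⟨α, hmem, hα⟩ := exists_exactForm φ
      rw [← formula φ α β hα]
      exact h α hmem
    refine ⟨?_, ?_, ?_, ?_⟩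
    · simpa [Finsupp.single_apply] using key (b.coord 3)
    · simpa [Finsupp.single_apply] using key (b.coord 2)
    · simpa [Finsupp.single_apply] using key (b.coord 1)
    · simpa [Finsupp.single_apply] using key (b.coord 0)

/-! ### Bases adapted to an almost complex structure -/

/-- An almost complex structure on a 4-dimensional space has a basis `x, J x, y, J y`. -/
lemma exists_adapted_basis (hdim : Module.finrank ℝ g = 4) {J : g →ₗ[ℝ] g}
    (hJ : IsAlmostComplex J) : ∃ b : Module.Basis (Fin 4) ℝ g, J (b 0) = b 1 ∧ J (b 2) = b 3 := by
  have : Nontrivial g := Module.nontrivial_of_finrank_pos (R := ℝ) (by omega)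
  have : Module.Finite ℝ g := Module.finite_of_finrank_pos (by omega)
  obtain ⟨x, hx⟩ := exists_ne (0 : g)
  have hS : Submodule.span ℝ {x, J x} ≠ ⊤ := by
    intro h
    have h2 : Module.finrank ℝ (Submodule.span ℝ {x, J x}) ≤ 2 := by
      classical
      have := finrank_span_finset_le_card (R := ℝ) ({x, J x} : Finset g)
      simp only [Finset.coe_insert, Finset.coe_singleton] at this
      exact this.trans Finset.card_le_two
    rw [h, finrank_top] at h2
    omega
  obtain ⟨y, hy⟩ : ∃ y, y ∉ Submodule.span ℝ {x, J x} := by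
    by_contra! h
    exact hS ((Submodule.eq_top_iff').2 h)
  have hli : LinearIndependent ℝ ![x, J x, y, J y] := by
    rw [Fintype.linearIndependent_iff]
    intro a ha
    simp only [Fin.sum_univ_four, Matrix.cons_val] at ha
    have ha' := congrArg J ha
    simp only [map_add, map_smul, map_zero, hJ _] at ha'
    -- The relation is a complex one, with J as i; multiplying by the conjugate of a 2 + i a 3 makes
    -- the coefficient of y real.
    have hy0 : a 2 ^ 2 + a 3 ^ 2 = 0 := by
      by_contra hne
      apply hy
      have e : (a 2 ^ 2 + a 3 ^ 2) • y = (-(a 2 * a 0 + a 3 * a 1)) • x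
          + (a 3 * a 0 - a 2 * a 1) • J x := by
        linear_combination (norm := module) a 2 • ha - a 3 • ha'
      rw [← inv_smul_smul₀ hne y, e]
      exact Submodule.smul_mem _ _ (Submodule.mem_span_pair.2 ⟨_, _, rfl⟩)
    have h2 : a 2 = 0 := by nlinarith [sq_nonneg (a 2), sq_nonneg (a 3)]
    have h3 : a 3 = 0 := by nlinarith [sq_nonneg (a 2), sq_nonneg (a 3)]
    have hx0 : a 0 ^ 2 + a 1 ^ 2 = 0 := by
      by_contra hne
      have e : (a 0 ^ 2 + a 1 ^ 2) • x = 0 := by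
        rw [h2, h3] at ha ha'
        linear_combination (norm := module) a 0 • ha - a 1 • ha'
      exact (smul_ne_zero hne hx) e
    have h0 : a 0 = 0 := by nlinarith [sq_nonneg (a 0), sq_nonneg (a 1)]
    have h1 : a 1 = 0 := by nlinarith [sq_nonneg (a 0), sq_nonneg (a 1)]
    intro i
    fin_cases i <;> assumption
  refine ⟨basisOfLinearIndependentOfCardEqFinrank hli (by simp [hdim]), ?_, ?_⟩ <;> simp

/-! ### Signature of the wedge form on closed forms -/

lemma exactForms_le_closedForms : exactForms g ≤ closedForms g := by
  intro α hα
  obtain ⟨φ, h⟩ := (mem_exactForms_iff α).1 hα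
  rw [mem_closedForms_iff]
  intro u v w
  rw [h, h, h, leibniz_lie, map_add]
  ring

/-- The 2-forms satisfying `*α = s α`, for `s = ±1` and the metric that makes the basis `b`
orthonormal. -/
def dualForms (b : Module.Basis (Fin 4) ℝ g) (s : ℝ) : Submodule ℝ (TwoForm g) :=
  LinearMap.range ((coordsEquiv b).symm.toLinearMap ∘ₗ
    ({ toFun := fun a => ![a 0, a 1, a 2, s * a 2, -(s * a 1), s * a 0]
       map_add' := fun a a' => by ext i; fin_cases i <;> simp <;> ring
       map_smul' := fun c a => by ext i; fin_cases i <;> simp <;> ring } :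
      (Fin 3 → ℝ) →ₗ[ℝ] Fin 6 → ℝ))

lemma finrank_dualForms (b : Module.Basis (Fin 4) ℝ g) (s : ℝ) :
    Module.finrank ℝ (dualForms b s) = 3 := by
  rw [dualForms, LinearMap.finrank_range_of_inj]
  · simp
  · refine (coordsEquiv b).symm.injective.comp fun a a' h => ?_
    have h0 := congrFun h 0
    have h1 := congrFun h 1
    have h2 := congrFun h 2
    simp at h0 h1 h2
    ext i
    fin_cases i <;> assumption

lemma mem_dualForms {b : Module.Basis (Fin 4) ℝ g} {s : ℝ} {α : TwoForm g}
    (hα : α ∈ dualForms b s) : α.ev (b 1) (b 2) = s * α.ev (b 0) (b 3) ∧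
      α.ev (b 1) (b 3) = -(s * α.ev (b 0) (b 2)) ∧ α.ev (b 2) (b 3) = s * α.ev (b 0) (b 1) := by
  obtain ⟨a, ha⟩ := hα
  have h : coords b α = ![a 0, a 1, a 2, s * a 2, -(s * a 1), s * a 0] :=
    (LinearEquiv.symm_apply_eq _).1 ha |>.symm
  rw [coords_apply] at h
  have H := fun i => congrFun h i
  have h0 := H 0
  have h1 := H 1
  have h2 := H 2
  have h3 := H 3
  have h4 := H 4
  have h5 := H 5
  simp only [Matrix.cons_val] at h0 h1 h2 h3 h4 h5
  rw [h0, h1, h2]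
  exact ⟨h3, h4, h5⟩

/-- Any s ≠ 0 is allowed, so s can be c or -c for the constant c of `pairing_eq`, whatever its sign.
-/
lemma wedgeForm_self_pos {b : Module.Basis (Fin 4) ℝ g} {s : ℝ} (hs : s ≠ 0) {α : TwoForm g}
    (hα : α ∈ dualForms b s) (h0 : α ≠ 0) : 0 < s * wedgeForm b α α := by
  obtain ⟨h12, h13, h23⟩ := mem_dualForms hα
  have hs2 : 0 < s ^ 2 := by positivity
  have e : s * wedgeForm b α α = 2 * s ^ 2 *
      (α.ev (b 0) (b 1) ^ 2 + α.ev (b 0) (b 2) ^ 2 + α.ev (b 0) (b 3) ^ 2) := by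
    rw [wedgeForm_apply, h12, h13, h23]
    ring
  rw [e]
  refine mul_pos (by positivity) ?_
  by_contra! hle
  apply h0
  have e1 : α.ev (b 0) (b 1) = 0 := by
    rw [← sq_eq_zero_iff]
    linarith [sq_nonneg (α.ev (b 0) (b 1)), sq_nonneg (α.ev (b 0) (b 2)),
      sq_nonneg (α.ev (b 0) (b 3))]
  have e2 : α.ev (b 0) (b 2) = 0 := by
    rw [← sq_eq_zero_iff]
    linarith [sq_nonneg (α.ev (b 0) (b 1)), sq_nonneg (α.ev (b 0) (b 2)),
      sq_nonneg (α.ev (b 0) (b 3))]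
  have e3 : α.ev (b 0) (b 3) = 0 := by
    rw [← sq_eq_zero_iff]
    linarith [sq_nonneg (α.ev (b 0) (b 1)), sq_nonneg (α.ev (b 0) (b 2)),
      sq_nonneg (α.ev (b 0) (b 3))]
  apply ext_basis b <;> simp [*]

lemma wedgeForm_comm (b : Fin 4 → g) (α β : TwoForm g) : wedgeForm b α β = wedgeForm b β α :=
  (wedgeForm_isSymm b).eq α β

lemma wedgeForm_exact_closed (hg : IsUnimodular g) (b : Module.Basis (Fin 4) ℝ g)
    {α β : TwoForm g} (hα : α ∈ exactForms g) (hβ : β ∈ closedForms g) :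
    wedgeForm b α β = 0 := by
  rw [closedForms_eq_orthogonal hg b] at hβ
  exact hβ α hα

lemma finrank_closedForms (hg : IsUnimodular g) (b : Module.Basis (Fin 4) ℝ g) :
    Module.finrank ℝ (closedForms g) + Module.finrank ℝ (exactForms g) = 6 := by
  have := finite_twoForm b
  have h := LinearMap.BilinForm.finrank_orthogonal (wedgeForm_nondegenerate b) (exactForms g)
  have h' := Submodule.finrank_le (exactForms g)
  rw [← closedForms_eq_orthogonal hg b, finrank_twoForm b] at h
  rw [finrank_twoForm b] at h'
  omega

/-- For unimodular `g`, the signature of the pairing on closed forms is determined by the dimension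
of the space of exact forms. -/
lemma bPlus_add_finrank_exactForms (hg : IsUnimodular g) (b : Module.Basis (Fin 4) ℝ g)
    (ζ : ⋀[ℝ]^4 g) (hζ : ζ ≠ 0) :
    bPlus ζ + Module.finrank ℝ (exactForms g) = 3 := by
  have := finite_twoForm b
  obtain ⟨c, hc, hp⟩ := pairing_eq b ζ hζ
  have upper : ∀ V : Submodule ℝ (TwoForm g), V ≤ closedForms g → IsPosDef ζ V →
      Module.finrank ℝ V + Module.finrank ℝ (exactForms g) ≤ 3 := by
    intro V hV hpos
    have hVB : V ⊓ exactForms g = ⊥ := by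
      rw [Submodule.eq_bot_iff]
      rintro α ⟨h1, h2⟩
      by_contra h0
      have := hpos α h1 h0
      rw [hp, wedgeForm_exact_closed hg b h2 (exactForms_le_closedForms h2)] at this
      simp at this
    -- The pairing is positive semidefinite on V + B, because B is isotropic and orthogonal to V,
    -- and negative definite on the 3-dimensional `dualForms b (-c)`.
    have hD : (V ⊔ exactForms g) ⊓ dualForms b (-c) = ⊥ := by
      rw [Submodule.eq_bot_iff]
      rintro α ⟨h1, h2⟩
      by_contra h0
      have neg := wedgeForm_self_pos (neg_ne_zero.2 hc) h2 h0
      obtain ⟨v, hv, β, hβ, rfl⟩ := Submodule.mem_sup.1 h1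
      have e1 := wedgeForm_exact_closed hg b hβ (hV hv)
      have e2 := wedgeForm_exact_closed hg b hβ (exactForms_le_closedForms hβ)
      simp only [map_add, LinearMap.add_apply, e1, e2, wedgeForm_comm b v β] at neg
      have : 0 ≤ pairing ζ v v := by
        by_cases hv0 : v = 0
        · simp [hp, hv0]
        · exact (hpos v hv hv0).le
      rw [hp] at this
      linarith
    have d1 := Submodule.finrank_sup_add_finrank_inf_eq V (exactForms g)
    have d2 := Submodule.finrank_sup_add_finrank_inf_eq (V ⊔ exactForms g) (dualForms b (-c))
    have d3 := Submodule.finrank_le ((V ⊔ exactForms g) ⊔ dualForms b (-c))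
    rw [hVB, finrank_bot] at d1
    rw [hD, finrank_bot, finrank_dualForms] at d2
    rw [finrank_twoForm b] at d3
    omega
  -- This intersection attains the bound: its dimension is at least (6 - r) + 3 - 6 = 3 - r.
  have hW : IsPosDef ζ (closedForms g ⊓ dualForms b c) := by
    intro α hα h0
    rw [hp]
    exact wedgeForm_self_pos hc hα.2 h0
  have dW := upper _ inf_le_left hW
  have d1 := Submodule.finrank_sup_add_finrank_inf_eq (closedForms g) (dualForms b c)
  have d2 := Submodule.finrank_le (closedForms g ⊔ dualForms b c)
  rw [finrank_dualForms] at d1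
  rw [finrank_twoForm b] at d2
  have d3 := finrank_closedForms hg b
  have : IsGreatest {n : ℕ | ∃ V : Submodule ℝ (TwoForm g),
      V ≤ closedForms g ∧ IsPosDef ζ V ∧ Module.finrank ℝ V = n}
      (3 - Module.finrank ℝ (exactForms g)) := by
    refine ⟨⟨_, inf_le_left, hW, by omega⟩, ?_⟩
    rintro n ⟨V, hV, hpos, rfl⟩
    have := upper V hV hpos
    omega
  rw [bPlus, this.csSup_eq]
  omega

/-! ### Invariant and anti-invariant forms -/

/-- The basis `b` has the form `x, J x, y, J y`. -/
structure IsAdapted (J : g →ₗ[ℝ] g) (b : Module.Basis (Fin 4) ℝ g) : Prop where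
  map_zero : J (b 0) = b 1
  map_one : J (b 1) = -b 0
  map_two : J (b 2) = b 3
  map_three : J (b 3) = -b 2

lemma exists_isAdapted (hdim : Module.finrank ℝ g = 4) {J : g →ₗ[ℝ] g}
    (hJ : IsAlmostComplex J) : ∃ b : Module.Basis (Fin 4) ℝ g, IsAdapted J b := by
  obtain ⟨b, h0, h2⟩ := exists_adapted_basis hdim hJ
  exact ⟨b, h0, by rw [← h0, hJ], h2, by rw [← h2, hJ]⟩

variable {J : g →ₗ[ℝ] g} {b : Module.Basis (Fin 4) ℝ g}

/-- The sign s = ±1 treats invariant and anti-invariant forms together. -/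
lemma ev_comp_eq_of_basis (hb : IsAdapted J b) (α : TwoForm g) (s : ℝ) (hs : s * s = 1)
    (h01 : α.ev (b 0) (b 1) = s * α.ev (b 0) (b 1)) (h23 : α.ev (b 2) (b 3) = s * α.ev (b 2) (b 3))
    (h13 : α.ev (b 1) (b 3) = s * α.ev (b 0) (b 2)) (h12 : α.ev (b 1) (b 2) = -(s * α.ev (b 0) (b 3)))
    (u v : g) : α.ev (J u) (J v) = s * α.ev u v := by
  have : α.ev.compl₁₂ J J = s • α.ev := by
    refine b.ext fun i => b.ext fun j => ?_
    have e02 : α.ev (b 0) (b 2) = s * α.ev (b 1) (b 3) := by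
      rw [h13, ← mul_assoc, hs, one_mul]
    have e03 : α.ev (b 0) (b 3) = -(s * α.ev (b 1) (b 2)) := by
      rw [h12, mul_neg, ← mul_assoc, hs, one_mul, neg_neg]
    have s01 := ev_swap α (b 0) (b 1)
    have s02 := ev_swap α (b 0) (b 2)
    have s03 := ev_swap α (b 0) (b 3)
    have s12 := ev_swap α (b 1) (b 2)
    have s13 := ev_swap α (b 1) (b 3)
    have s23 := ev_swap α (b 2) (b 3)
    fin_cases i <;> fin_cases j <;>
      simp only [Fin.zero_eta, Fin.mk_one, Fin.reduceFinMk, LinearMap.compl₁₂_apply,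
        LinearMap.smul_apply, smul_eq_mul, hb.map_zero, hb.map_one, hb.map_two, hb.map_three,
        map_neg, LinearMap.neg_apply, ev_self, s01, s02, s03, s12, s13, s23] <;> linarith
  exact congr($this u v)

lemma mem_antiInvariant_iff (hb : IsAdapted J b) (α : TwoForm g) :
    α ∈ antiInvariant J ↔ α.ev (b 0) (b 1) = 0 ∧ α.ev (b 2) (b 3) = 0 ∧
      α.ev (b 1) (b 3) = -α.ev (b 0) (b 2) ∧ α.ev (b 1) (b 2) = α.ev (b 0) (b 3) := by
  constructor
  · intro h
    have h01 := h (b 0) (b 1)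
    have h23 := h (b 2) (b 3)
    have h02 := h (b 0) (b 2)
    have h03 := h (b 0) (b 3)
    simp only [hb.map_zero, hb.map_one, hb.map_two, hb.map_three, map_neg] at h01 h23 h02 h03
    rw [ev_swap α (b 0) (b 1)] at h01
    rw [ev_swap α (b 2) (b 3)] at h23
    exact ⟨by linarith, by linarith, h02, by linarith⟩
  · rintro ⟨h01, h23, h13, h12⟩ u v
    rw [ev_comp_eq_of_basis hb α (-1) (by norm_num) (by linarith) (by linarith) (by linarith)
      (by linarith)]
    ring

lemma mem_orthogonal_antiInvariant_iff_basis (hb : IsAdapted J b) (ψ : TwoForm g) :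
    ψ ∈ (wedgeForm b).orthogonal (antiInvariant J) ↔
      ψ.ev (b 1) (b 3) = ψ.ev (b 0) (b 2) ∧ ψ.ev (b 1) (b 2) = -ψ.ev (b 0) (b 3) := by
  rw [LinearMap.BilinForm.mem_orthogonal_iff]
  constructor
  · intro h
    have key := fun a : Fin 6 → ℝ => h ((coordsEquiv b).symm a)
    have hc : ∀ a, coords b ((coordsEquiv b).symm a) = a := (coordsEquiv b).apply_symm_apply
    simp only [mem_antiInvariant_iff hb] at key
    have hc' := fun a i => congrFun (hc a) i
    simp only [coords_apply] at hc'
    constructor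
    -- The two test forms e⁰² - e¹³ and e⁰³ + e¹² span Λ⁻.
    · have := key ![0, 1, 0, 0, -1, 0]
      have H := hc' ![0, 1, 0, 0, -1, 0]
      have h0 := H 0
      have h1 := H 1
      have h2 := H 2
      have h3 := H 3
      have h4 := H 4
      have h5 := H 5
      simp only [Matrix.cons_val] at h0 h1 h2 h3 h4 h5
      have := this (by simp [*])
      simp only [wedgeForm_apply, h0, h1, h2, h3, h4, h5] at this
      linarith
    · have := key ![0, 0, 1, 1, 0, 0]
      have H := hc' ![0, 0, 1, 1, 0, 0]
      have h0 := H 0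
      have h1 := H 1
      have h2 := H 2
      have h3 := H 3
      have h4 := H 4
      have h5 := H 5
      simp only [Matrix.cons_val] at h0 h1 h2 h3 h4 h5
      have := this (by simp [*])
      simp only [wedgeForm_apply, h0, h1, h2, h3, h4, h5] at this
      linarith
  · rintro ⟨h13, h12⟩ α hα
    obtain ⟨a01, a23, a13, a12⟩ := (mem_antiInvariant_iff hb α).1 hα
    rw [wedgeForm_apply, a01, a23, a13, a12, h13, h12]
    ring

/-- J preserves orientation, so the wedge form is J-invariant and the two eigenspaces of J on Λ² are
orthogonal complements. -/
lemma mem_orthogonal_antiInvariant_iff (hb : IsAdapted J b) (ψ : TwoForm g) :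
    ψ ∈ (wedgeForm b).orthogonal (antiInvariant J) ↔ ∀ u v, ψ.ev (J u) (J v) = ψ.ev u v := by
  rw [mem_orthogonal_antiInvariant_iff_basis hb]
  constructor
  · rintro ⟨h13, h12⟩ u v
    rw [ev_comp_eq_of_basis hb ψ 1 (by norm_num) (by linarith) (by linarith) (by linarith)
      (by linarith), one_mul]
  · intro h
    have h02 := h (b 0) (b 2)
    have h03 := h (b 0) (b 3)
    simp only [hb.map_zero, hb.map_two, hb.map_three, map_neg] at h02 h03
    exact ⟨h02, by linarith⟩

lemma finrank_antiInvariant (hb : IsAdapted J b) :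
    Module.finrank ℝ (antiInvariant J) = 2 := by
  let f : (Fin 2 → ℝ) →ₗ[ℝ] TwoForm g := (coordsEquiv b).symm.toLinearMap ∘ₗ
    { toFun := fun a => ![0, a 0, a 1, a 1, -a 0, 0]
      map_add' := fun a a' => by ext i; fin_cases i <;> (simp; try ring)
      map_smul' := fun c a => by ext i; fin_cases i <;> simp }
  have hf : Function.Injective f := by
    refine (coordsEquiv b).symm.injective.comp fun a a' h => ?_
    have h0 := congrFun h 1
    have h1 := congrFun h 2
    simp at h0 h1
    ext i
    fin_cases i <;> assumption
  have hr : LinearMap.range f = antiInvariant J := by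
    ext α
    rw [mem_antiInvariant_iff hb, LinearMap.mem_range]
    have key : ∀ a : Fin 2 → ℝ, f a = α ↔ ![0, a 0, a 1, a 1, -a 0, 0] = coords b α :=
      fun a => LinearEquiv.symm_apply_eq (coordsEquiv b)
    constructor
    · rintro ⟨a, ha⟩
      have h := fun i => congrFun ((key a).1 ha) i
      have h0 := h 0
      have h1 := h 1
      have h2 := h 2
      have h3 := h 3
      have h4 := h 4
      have h5 := h 5
      simp only [coords_apply, Matrix.cons_val] at h0 h1 h2 h3 h4 h5
      exact ⟨h0.symm, h5.symm, by linarith, by linarith⟩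
    · rintro ⟨h01, h23, h13, h12⟩
      refine ⟨![α.ev (b 0) (b 2), α.ev (b 0) (b 3)], (key _).2 ?_⟩
      rw [coords_apply, h01, h23, h13, h12]
      simp
  rw [← hr, LinearMap.finrank_range_of_inj hf]
  simp

/-- On Λ⁻ the wedge square is twice the sum of squares of the 02 and 03 coordinates. -/
lemma eq_zero_of_mem_antiInvariant (hb : IsAdapted J b) {α : TwoForm g}
    (hα : α ∈ antiInvariant J) (h : wedgeForm b α α = 0) : α = 0 := by
  obtain ⟨a01, a23, a13, a12⟩ := (mem_antiInvariant_iff hb α).1 hα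
  rw [wedgeForm_apply, a01, a23, a13, a12] at h
  have e2 : α.ev (b 0) (b 2) = 0 := by
    rw [← sq_eq_zero_iff]
    linarith [sq_nonneg (α.ev (b 0) (b 2)), sq_nonneg (α.ev (b 0) (b 3))]
  have e3 : α.ev (b 0) (b 3) = 0 := by
    rw [← sq_eq_zero_iff]
    linarith [sq_nonneg (α.ev (b 0) (b 2)), sq_nonneg (α.ev (b 0) (b 3))]
  apply ext_basis b <;> simp [*]

/-! ### Dimension of the closed anti-invariant forms -/

/-- `h⁻_J` is the dimension of the space of closed anti-invariant forms. -/
lemma hMinus_eq (hg : IsUnimodular g) (hb : IsAdapted J b) :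
    hMinus J = Module.finrank ℝ (closedForms g ⊓ antiInvariant J : Submodule ℝ (TwoForm g)) := by
  let f : (closedForms g ⊓ antiInvariant J : Submodule ℝ (TwoForm g)) →ₗ[ℝ] H2 g :=
    ((exactForms g).comap (closedForms g).subtype).mkQ ∘ₗ Submodule.inclusion inf_le_left
  have hf : Function.Injective f := by
    rw [← LinearMap.ker_eq_bot, LinearMap.ker_eq_bot']
    rintro ⟨α, hZ, hM⟩ h
    -- An exact form has zero wedge square, so an exact anti-invariant form vanishes.
    have hB : α ∈ exactForms g :=
      (Submodule.Quotient.mk_eq_zero ((exactForms g).comap (closedForms g).subtype)).1 h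
    exact Subtype.ext (eq_zero_of_mem_antiInvariant hb hM (wedgeForm_exact_closed hg b hB hZ))
  have hr : LinearMap.range f = HMinus J := by
    ext x
    constructor
    · rintro ⟨⟨α, hZ, hM⟩, rfl⟩
      exact ⟨⟨α, hZ⟩, hM, rfl⟩
    · rintro ⟨⟨α, hZ⟩, hM, rfl⟩
      exact ⟨⟨α, hZ, hM⟩, rfl⟩
  rw [hMinus, ← hr, LinearMap.finrank_range_of_inj hf]

/-- Nondegeneracy turns Z = B^⊥ into Z^⊥ = B. -/
lemma orthogonal_closedForms_sup (hg : IsUnimodular g) (b : Module.Basis (Fin 4) ℝ g)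
    (M : Submodule ℝ (TwoForm g)) :
    (wedgeForm b).orthogonal (closedForms g ⊔ M) =
      exactForms g ⊓ (wedgeForm b).orthogonal M := by
  have := finite_twoForm b
  have hB := LinearMap.BilinForm.orthogonal_orthogonal (wedgeForm_nondegenerate b)
    (wedgeForm_isSymm b).isRefl (exactForms g)
  rw [← closedForms_eq_orthogonal hg b] at hB
  apply le_antisymm
  · refine le_inf ?_ (LinearMap.BilinForm.orthogonal_le le_sup_right)
    rw [← hB]
    exact LinearMap.BilinForm.orthogonal_le le_sup_left
  · rintro ψ ⟨h1, h2⟩ α hα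
    obtain ⟨z, hz, m, hm, rfl⟩ := Submodule.mem_sup.1 hα
    have e1 := h2 m hm
    have e2 := wedgeForm_exact_closed hg b h1 hz
    rw [wedgeForm_comm] at e2
    rw [map_add, LinearMap.add_apply, e2, zero_add]
    exact e1

lemma finrank_closedForms_sup_add (hg : IsUnimodular g) (b : Module.Basis (Fin 4) ℝ g)
    (M : Submodule ℝ (TwoForm g)) :
    Module.finrank ℝ (closedForms g ⊔ M : Submodule ℝ (TwoForm g)) + Module.finrank ℝ
      (exactForms g ⊓ (wedgeForm b).orthogonal M : Submodule ℝ (TwoForm g)) = 6 := by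
  have := finite_twoForm b
  have h := LinearMap.BilinForm.finrank_orthogonal (wedgeForm_nondegenerate b) (closedForms g ⊔ M)
  have h' := Submodule.finrank_le (closedForms g ⊔ M)
  rw [orthogonal_closedForms_sup hg b, finrank_twoForm b] at h
  rw [finrank_twoForm b] at h'
  omega

lemma finrank_closed_inf_antiInvariant (hg : IsUnimodular g) (hb : IsAdapted J b) :
    Module.finrank ℝ (closedForms g ⊓ antiInvariant J : Submodule ℝ (TwoForm g))
      + Module.finrank ℝ (exactForms g) = 2 + Module.finrank ℝ
      (exactForms g ⊓ (wedgeForm b).orthogonal (antiInvariant J) : Submodule ℝ (TwoForm g)) := by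
  have := finite_twoForm b
  have h1 := finrank_closedForms_sup_add hg b (antiInvariant J)
  have h2 := finrank_closedForms hg b
  have h3 := Submodule.finrank_sup_add_finrank_inf_eq (closedForms g) (antiInvariant J)
  rw [finrank_antiInvariant hb] at h3
  omega

lemma ev_map_self_eq_zero (hJ : IsAlmostComplex J) {α : TwoForm g} (hα : α ∈ antiInvariant J)
    (v : g) : α.ev v (J v) = 0 := by
  have := hα v (J v)
  rw [hJ, map_neg, ev_swap α v (J v)] at this
  linarith

/-! ### Criteria for tameness and integrability -/

/-- `J` is tamed iff no nonzero exact 2-form is `J`-invariant. -/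
lemma isTamed_iff (hg : IsUnimodular g) (hJ : IsAlmostComplex J) (hb : IsAdapted J b) :
    IsTamed J ↔ exactForms g ⊓ (wedgeForm b).orthogonal (antiInvariant J) = ⊥ := by
  have := finite_twoForm b
  constructor
  · rintro ⟨φ, hφ, hpos⟩
    rw [Submodule.eq_bot_iff]
    rintro ψ ⟨hB, hM⟩
    obtain ⟨h13, h12⟩ := (mem_orthogonal_antiInvariant_iff_basis hb ψ).1 hM
    have e1 := wedgeForm_exact_closed hg b hB (exactForms_le_closedForms hB)
    have e2 := wedgeForm_exact_closed hg b hB hφ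
    rw [wedgeForm_apply, h13, h12] at e1 e2
    have z : ψ.ev (b 0) (b 1) = 0 := by
      by_contra h0
      -- As ψ is invariant with ψ ∧ ψ = 0, this vector v and J v span its kernel. Modulo ψ ∧ ψ, φ(v,
      -- J v) is ψ(b 0, b 1) times ψ ∧ φ, hence zero.
      have hv : -(ψ.ev (b 0) (b 3)) • b 0 - (ψ.ev (b 0) (b 2)) • b 1
          + (ψ.ev (b 0) (b 1)) • b 2 ≠ 0 := by
        intro h
        have := congrArg (b.coord 2) h
        simp at this
        exact h0 this
      have := hpos _ hv
      simp only [map_add, map_sub, map_smul, LinearMap.add_apply, LinearMap.sub_apply,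
        LinearMap.smul_apply, smul_eq_mul, hb.map_zero, hb.map_one, hb.map_two, map_neg,
        ev_self, ev_swap φ (b 0) (b 1), ev_swap φ (b 0) (b 2), ev_swap φ (b 1) (b 2)] at this
      refine this.ne' ?_
      linear_combination ψ.ev (b 0) (b 1) * e2 - φ.ev (b 0) (b 1) / 2 * e1
    -- With ψ(b 0, b 1) = 0, ψ ∧ ψ = 0 kills the mixed coordinates; then ψ ∧ φ = 0 reads φ(b 0, b 1)
    -- ψ(b 2, b 3) = 0.
    have p := hpos (b 0) (b.ne_zero 0)
    rw [hb.map_zero] at p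
    rw [z] at e1 e2
    have e2' : ψ.ev (b 0) (b 2) = 0 := by
      rw [← sq_eq_zero_iff]
      linarith [sq_nonneg (ψ.ev (b 0) (b 2)), sq_nonneg (ψ.ev (b 0) (b 3))]
    have e3' : ψ.ev (b 0) (b 3) = 0 := by
      rw [← sq_eq_zero_iff]
      linarith [sq_nonneg (ψ.ev (b 0) (b 2)), sq_nonneg (ψ.ev (b 0) (b 3))]
    have e4 : ψ.ev (b 2) (b 3) = 0 := by
      simpa [e2', e3', p.ne'] using e2
    apply ext_basis b <;> simp [*]
  · intro h
    have htop : closedForms g ⊔ antiInvariant J = ⊤ := by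
      apply Submodule.eq_top_of_finrank_eq
      have := finrank_closedForms_sup_add hg b (antiInvariant J)
      rw [h, finrank_bot] at this
      rw [finrank_twoForm b, ← this, add_zero]
    -- ω(v, J v) is the squared norm of v, and removing the anti-invariant part of ω = φ + α does
    -- not change it.
    let ω : TwoForm g := wedgeOne (b.coord 0) (b.coord 1) + wedgeOne (b.coord 2) (b.coord 3)
    obtain ⟨φ, hφ, α, hα, hω⟩ := Submodule.mem_sup.1 (htop ▸ Submodule.mem_top : ω ∈ _)
    refine ⟨φ, hφ, fun v hv => ?_⟩
    have hJv : ∀ i, b.coord i (J v) =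
        ![-(b.coord 1 v), b.coord 0 v, -(b.coord 3 v), b.coord 2 v] i := by
      intro i
      conv_lhs => rw [← b.sum_repr v, Fin.sum_univ_four]
      fin_cases i <;> simp [hb.map_zero, hb.map_one, hb.map_two, hb.map_three]
    have e : φ.ev v (J v) = b.coord 0 v ^ 2 + b.coord 1 v ^ 2 + b.coord 2 v ^ 2
        + b.coord 3 v ^ 2 := by
      have := congrArg (fun β => TwoForm.ev β v (J v)) hω
      simp only [add_ev, ev_map_self_eq_zero hJ hα, add_zero, ω, wedgeOne_ev, hJv,
        Matrix.cons_val] at this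
      rw [this]
      ring
    rw [e]
    by_contra! hle
    apply hv
    apply b.ext_elem
    have nn := fun i => sq_nonneg (b.coord i v)
    have n0 := nn 0
    have n1 := nn 1
    have n2 := nn 2
    have n3 := nn 3
    have sq : ∀ i, b.coord i v ^ 2 = 0 := by
      intro i
      fin_cases i <;> simp only [Fin.zero_eta, Fin.mk_one, Fin.reduceFinMk] <;> linarith
    intro i
    simpa using sq i

/-- J has no real eigenvalue; multiplying by the conjugate p - qJ leaves (p² + q²) e = 0. -/
lemma eq_zero_of_smul_add_smul_map (hJ : IsAlmostComplex J) {e : g} (he : e ≠ 0) {p q : ℝ}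
    (h : p • e + q • J e = 0) : p = 0 := by
  have h' := congrArg J h
  simp only [map_add, map_smul, hJ e, map_zero] at h'
  have : (p ^ 2 + q ^ 2) • e = 0 := by
    linear_combination (norm := module) p • h - q • h'
  have := (smul_eq_zero.1 this).resolve_right he
  rw [← sq_eq_zero_iff]
  linarith [sq_nonneg p, sq_nonneg q]

/-- If the derived algebra is a line, `J` is integrable iff every exact 2-form is `J`-invariant. -/
lemma isIntegrable_iff (hJ : IsAlmostComplex J) (hb : IsAdapted J b)
    (h1 : Module.finrank ℝ (exactForms g) = 1) :
    IsIntegrable J ↔ exactForms g ≤ (wedgeForm b).orthogonal (antiInvariant J) := by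
  obtain ⟨⟨ω, hω⟩, hne, hspan⟩ := finrank_eq_one_iff'.1 h1
  have hω0 : ω ≠ 0 := fun h => hne (Subtype.ext h)
  have hle : exactForms g ≤ (wedgeForm b).orthogonal (antiInvariant J) ↔
      ∀ u v, ω.ev (J u) (J v) = ω.ev u v := by
    rw [← mem_orthogonal_antiInvariant_iff hb]
    refine ⟨fun h => h hω, fun h α hα => ?_⟩
    obtain ⟨c, hc⟩ := hspan ⟨α, hα⟩
    have : c • ω = α := congrArg Subtype.val hc
    rw [← this]
    exact Submodule.smul_mem _ _ h
  -- Every component of the bracket is a multiple of ω, so [u, v] = ω(u, v) e. The Nijenhuis tensor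
  -- is then (ω(u, v) - ω(Ju, Jv)) e + (ω(Ju, v) + ω(u, Jv)) Je.
  have hlin : ∀ φ : g →ₗ[ℝ] ℝ, ∃ c : ℝ, ∀ u v, φ ⁅u, v⁆ = c * ω.ev u v := by
    intro φ
    obtain ⟨α, hmem, hα⟩ := exists_exactForm φ
    obtain ⟨c, hc⟩ := hspan ⟨α, hmem⟩
    have hc' : c • ω = α := congrArg Subtype.val hc
    refine ⟨-c, fun u v => ?_⟩
    have := hα u v
    rw [← hc', smul_ev] at this
    linarith
  choose c hc using fun i => hlin (b.coord i)
  set e : g := ∑ i, c i • b i with he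
  have hbr : ∀ u v : g, ⁅u, v⁆ = ω.ev u v • e := by
    intro u v
    rw [← b.sum_repr ⁅u, v⁆, he, Finset.smul_sum]
    refine Finset.sum_congr rfl fun i _ => ?_
    have := hc i u v
    rw [Module.Basis.coord_apply] at this
    rw [this, smul_smul, mul_comm]
  have he0 : e ≠ 0 := by
    intro h
    obtain ⟨φ, hφ⟩ := (mem_exactForms_iff ω).1 hω
    apply hω0
    apply ext_ev
    intro u v
    rw [hφ, hbr, h]
    simp
  rw [hle]
  constructor
  · intro hN u v
    have := hN u v
    simp only [hbr, map_smul] at this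
    have := eq_zero_of_smul_add_smul_map hJ he0 (p := ω.ev u v - ω.ev (J u) (J v))
      (q := ω.ev (J u) v + ω.ev u (J v)) (by rw [← this]; module)
    linarith
  · intro hinv u v
    -- Invariance at (u, J v) also cancels the coefficient of Je.
    have := hinv u (J v)
    rw [hJ, map_neg] at this
    simp only [hbr, map_smul, hinv u v, ← this]
    module

end LieAC

end

/-! ### The cases b⁺ = 3, 2, 1 -/

theorem corollary3p8 {g : Type*} [LieRing g] [LieAlgebra ℝ g]
    (hdim : Module.finrank ℝ g = 4) (hg : LieAC.IsUnimodular g)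
    (ζ : ⋀[ℝ]^4 g) (hζ : ζ ≠ 0) :
    (LieAC.bPlus ζ = 3 → ∀ J : g →ₗ[ℝ] g, LieAC.IsAlmostComplex J →
      LieAC.IsTamed J ∧ LieAC.IsIntegrable J ∧ LieAC.hMinus J = 2) ∧
    (LieAC.bPlus ζ = 2 → ∀ J : g →ₗ[ℝ] g, LieAC.IsAlmostComplex J →
      Xor (LieAC.IsTamed J) (LieAC.IsIntegrable J) ∧
      (LieAC.IsTamed J ↔ LieAC.hMinus J = 1) ∧
      (LieAC.IsIntegrable J ↔ LieAC.antiInvariant J ≤ LieAC.closedForms g)) ∧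
    (LieAC.bPlus ζ = 1 → ∀ J : g →ₗ[ℝ] g, LieAC.IsAlmostComplex J →
      Xor (LieAC.IsTamed J) (LieAC.antiInvariant J ⊓ LieAC.closedForms g ≠ ⊥)) := by
  open LieAC in
  refine ⟨fun h J hJ => ?_, fun h J hJ => ?_, fun h J hJ => ?_⟩ <;>
  obtain ⟨b, hb⟩ := exists_isAdapted hdim hJ <;>
  have := finite_twoForm b <;>
  have hB := bPlus_add_finrank_exactForms hg b ζ hζ <;>
  have hM := finrank_closed_inf_antiInvariant hg hb <;>
  have hT := isTamed_iff hg hJ hb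
  · have hB0 : exactForms g = ⊥ := by
      apply Submodule.finrank_eq_zero.1
      omega
    -- Without exact forms every coordinate of every bracket vanishes: g is abelian.
    have hlie : ∀ u v : g, ⁅u, v⁆ = 0 := by
      intro u v
      apply b.ext_elem
      intro i
      obtain ⟨α, hmem, hα⟩ := exists_exactForm (b.coord i)
      rw [hB0, Submodule.mem_bot] at hmem
      simpa [hmem] using hα u v
    refine ⟨hT.2 (by rw [hB0, bot_inf_eq]), fun u v => by simp [hlie], ?_⟩
    rw [hB0, bot_inf_eq, finrank_bot] at hM
    rw [hMinus_eq hg hb]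
    exact hM
  · have hB1 : Module.finrank ℝ (exactForms g) = 1 := by omega
    -- B is a line, so it either lies in Λ⁺ or meets it trivially.
    have hI : IsIntegrable J ↔ ¬ IsTamed J := by
      rw [isIntegrable_iff hJ hb hB1, hT, ← Submodule.finrank_eq_zero]
      constructor
      · intro hle
        rw [inf_eq_left.2 hle]
        omega
      · intro hne
        rw [← inf_eq_left]
        apply Submodule.eq_of_le_of_finrank_le inf_le_left
        omega
    -- Hence dim(Z ∩ Λ⁻) = 1 + dim(B ∩ Λ⁺) is 1 or 2, and 2 means that Λ⁻ ⊂ Z.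
    have hr : Module.finrank ℝ (exactForms g ⊓ (wedgeForm b).orthogonal (antiInvariant J) :
        Submodule ℝ (TwoForm g)) ≤ 1 := hB1 ▸ Submodule.finrank_mono inf_le_left
    rw [← Submodule.finrank_eq_zero] at hT
    refine ⟨?_, ?_, ?_⟩
    · by_cases ht : IsTamed J
      · exact Or.inl ⟨ht, fun hi => hI.1 hi ht⟩
      · exact Or.inr ⟨hI.2 ht, ht⟩
    · rw [hMinus_eq hg hb, hT]
      omega
    · rw [hI, hT, ← inf_eq_right]
      have hA := finrank_antiInvariant hb
      constructor
      · intro hne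
        apply Submodule.eq_of_le_of_finrank_le inf_le_right
        omega
      · intro he
        rw [he] at hM
        omega
  -- Here r = 2, so Z ∩ Λ⁻ and B ∩ Λ⁺ have equal dimension.
  · have hiff : IsTamed J ↔ antiInvariant J ⊓ closedForms g = ⊥ := by
      rw [hT, inf_comm (antiInvariant J), ← Submodule.finrank_eq_zero, ← Submodule.finrank_eq_zero]
      omega
    by_cases ht : IsTamed J
    · exact Or.inl ⟨ht, fun hne => hne (hiff.1 ht)⟩
    · exact Or.inr ⟨fun h0 => ht (hiff.2 h0), ht⟩
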